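/- **Setting.** A periodic soft real-time task has period $T>0$, relative deadline $D>0$ and a finite relative dismiss point $\delta\ge 0$. Job $J_j$ ($j=1,2,\dots$) is released at time $(j-1)T$, has absolute deadline $(j-1)T+D$, and whatever is left of it at time $(j-1)T+D+\delta$ is dismissed. The execution times $C_1,C_2,\dots$ are independent, with $\mathbb P(C_j=e_k)=p_k>0$ for $k=1,\dots,h$, where $0<e_1<\dots<e_h$ and $\sum_k p_k=1$. The supply in $[(j-1)T,(j-1)T+t)$ is a deterministic function $\beta_j(t)$, $0\le t\le T$, with $\beta_j(0)=0$, non-decreasing, $\beta_j(t+\epsilon)\le\beta_j(t)+\epsilon$ for $\epsilon>0$, $t+\epsilon\le T$, and $\beta_{j+Q}=\beta_j$ for all $j$, for a fixed integer $Q\ge 1$. A greedy processing component uses this supply to serve the pending (released, unfinished, not dismissed) jobs first-come-first-serve. Let $\mathrm{DM}(j)=1$ if $J_j$ is not finished by its deadline and $\mathrm{DM}(j)=0$ otherwise, and $\mathrm{DMR}_N=\frac1N\sum_{j=1}^N\mathrm{DM}(j)$. The deadline miss rate is the constant $\mathrm{DMR}$, if there is one, with $\mathbb P(\lim_{N\to\infty}\mathrm{DMR}_N=\mathrm{DMR})=1$.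 **Constructed chain.** For $t\ge0$ put $service(j,t)=\sum_{\ell=j}^{j+\lfloor t/T\rfloor-1}\beta_\ell(T)+\beta_{j+\lfloor t/T\rfloor}(t-T\lfloor t/T\rfloor)$. A state consists of a phase $j\in\{1,\dots,Q\}$, a deadline hit/miss mark and a remaining execution time. If a job in phase $j$ has execution time $e_k$ and its predecessor has left the remaining execution time $w$ ($w=0$ for the first job), then the state of the job is marked as a miss if and only if $w+e_k>service(j,D)$, and its remaining execution time is $\max\{\min\{w+e_k,service(j,D+\delta)\}-\beta_j(T),0\}$. The construction starts with the states of the first job (phase $1$, $w=0$, all $k$) and repeatedly adds all successor states (next phase, with phase $Q$ followed by phase $1$, and all $k$), identical states being merged; it terminates if the resulting set $S$ of states is finite. The directed graph on $S$ has an edge from $s$ to $r$ if some $e_k$ leads from $s$ to $r$, and the transition matrix is $P_{r,s}=\sum_{k:\,e_k\text{ leads from }s\text{ to }r}p_k$. Let $S_{\mathrm{DM}}\subseteq S$ be the set of the states marked as a miss. **Statement.** If $T$, $D$, $\delta$, all $e_k$ and all values $\beta_j(t)$ at integers $t\in[0,T]$ are integers, then the construction terminates. Whenever the construction terminates (with arbitrary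 real data) and the directed graph is strongly connected, the chain is irreducible, it has a unique stationary distribution $\pi$ (that is, $\pi\ge0$, $\sum_{s\in S}\pi_s=1$, $P\pi=\pi$), and the deadline miss rate of the task exists and is given by $$\mathrm{DMR}=\sum_{s\in S_{\mathrm{DM}}}\pi_s .$$ -/

import Mathlib

open Filter Topology MeasureTheory ProbabilityTheory

noncomputable section

/-- A periodic soft real-time task: period `T`, relative deadline `D`, relative dismiss point `δ`
after the deadline, and `h` possible execution times `e 0 < e 1 < ⋯` with probabilities `p k`.
Jobs are numbered from `0`, so job `n` is released at time `n * T`. -/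
structure SoftTask (h : ℕ) where
  T : ℝ
  D : ℝ
  δ : ℝ
  e : Fin h → ℝ
  p : Fin h → ℝ
  T_pos : 0 < T
  D_pos : 0 < D
  δ_nonneg : 0 ≤ δ
  e_strictMono : StrictMono e
  e_pos : ∀ k, 0 < e k
  p_pos : ∀ k, 0 < p k
  p_sum : ∑ k, p k = 1

/-- Supply functions for the period length `T`: for `0 ≤ t ≤ T`, `β n t` is the amount of service
provided in `[n * T, n * T + t)`. The pattern repeats every `Q` jobs. Values of `β n` outside
`[0, T]` are irrelevant. -/
structure SupplyFunctions (T : ℝ) where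
  β : ℕ → ℝ → ℝ
  Q : ℕ
  Q_pos : 0 < Q
  zero : ∀ n, β n 0 = 0
  mono : ∀ n, MonotoneOn (β n) (Set.Icc 0 T)
  unit_rate : ∀ n t ε, 0 ≤ t → 0 < ε → t + ε ≤ T → β n (t + ε) ≤ β n t + ε
  periodic : ∀ n, ∀ t ∈ Set.Icc 0 T, β (n + Q) t = β n t

/-- The accumulative service provided in `[n * T, n * T + t)`, for any `t ≥ 0`. -/
def SupplyFunctions.service {T : ℝ} (B : SupplyFunctions T) (n : ℕ) (t : ℝ) : ℝ :=
  (∑ l ∈ Finset.Ico n (n + ⌊t / T⌋₊), B.β l T) + B.β (n + ⌊t / T⌋₊) (t - T * ⌊t / T⌋₊)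

namespace SoftTask

variable {h : ℕ} (τ : SoftTask h) (B : SupplyFunctions τ.T)

/-! ### The execution of the jobs by the greedy first-come-first-serve processing component -/

/-- Release time of job `n`. -/
def release (n : ℕ) : ℝ := n * τ.T

/-- Absolute deadline of job `n`. -/
def deadline (n : ℕ) : ℝ := τ.release n + τ.D

/-- Absolute dismiss point of job `n`. -/
def dismissPoint (n : ℕ) : ℝ := τ.release n + τ.D + τ.δ

/-- Service received up to time `t` by a job with execution time `c` that is greedily served
between its release `r` and its dismiss point `d` from a supply whose accumulative amount
in `[0, x)` is `U x`: it takes whatever is supplied after `r`, until it has received `c` or until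
it is dismissed at `d`. -/
def greedyService (U : ℝ → ℝ) (c r d t : ℝ) : ℝ :=
  min c (U (min t d) - U (min t r))

/-- `leftover c n t` is the amount of service in `[0, t)` which is not consumed by the jobs
before job `n`, when job `i` has execution time `c i`. The jobs are served
first-come-first-serve: an earlier job takes all of the supply that its own predecessors leave
while it is pending, and a job is served from what all earlier jobs leave. -/
def leftover (c : ℕ → ℝ) : ℕ → ℝ → ℝ
  | 0 => fun t => B.service 0 t
  | n + 1 => fun t => leftover c n t -
      greedyService (leftover c n) (c n) (τ.release n) (τ.dismissPoint n) t

/-- The service which job `n` receives in `[0, t)`. -/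
def received (c : ℕ → ℝ) (n : ℕ) (t : ℝ) : ℝ :=
  greedyService (τ.leftover B c n) (c n) (τ.release n) (τ.dismissPoint n) t

/-- Job `n` misses its deadline: it is not completely served by then. -/
def MissesDeadline (c : ℕ → ℝ) (n : ℕ) : Prop :=
  τ.received B c n (τ.deadline n) < c n

open Classical in
/-- The indicator of a deadline miss of job `n`. -/
def DM (c : ℕ → ℝ) (n : ℕ) : ℝ := if τ.MissesDeadline B c n then 1 else 0

/-- The deadline miss rate of the first `N` jobs. -/
def DMRFirst (c : ℕ → ℝ) (N : ℕ) : ℝ := (1 / (N : ℝ)) * ∑ n ∈ Finset.range N, τ.DM B c n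

/-- `C n`, `n = 0, 1, …`, are independent random execution times with the distribution
given by `τ`. -/
def IsExecutionTimes {Ω : Type*} [MeasurableSpace Ω] (μ : Measure Ω) (C : ℕ → Ω → ℝ) : Prop :=
  (∀ n, Measurable (C n)) ∧ iIndepFun C μ ∧
    ∀ n k, μ {ω | C n ω = τ.e k} = ENNReal.ofReal (τ.p k)

/-- `x` is the (long run) deadline miss rate: `DMRFirst` converges to `x` almost surely. -/
def IsDeadlineMissRate {Ω : Type*} [MeasurableSpace Ω] (μ : Measure Ω) (C : ℕ → Ω → ℝ)
    (x : ℝ) : Prop :=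
  ∀ᵐ ω ∂μ, Tendsto (fun N : ℕ => τ.DMRFirst B (fun n => C n ω) N) atTop (𝓝 x)

/-! ### The constructed Markov chain -/

/-- A candidate state: the number `phase` of the job modulo `Q`, whether that job misses its
deadline, and the remaining execution time at the end of the job's period, excluding what will be
dismissed. -/
@[ext]
structure State where
  phase : ℕ
  miss : Prop
  rem : ℝ

/-- The state of a job in phase `j` with execution time `x` if its predecessor has left the
remaining execution time `w`. -/
def stateOf (j : ℕ) (w x : ℝ) : State where
  phase := j
  miss := B.service j τ.D < w + x
  rem := max (min (w + x) (B.service j (τ.D + τ.δ)) - B.β j τ.T) 0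

/-- The state of the first job with execution time `e k`. -/
def initialState (k : Fin h) : State := τ.stateOf B 0 0 (τ.e k)

/-- The state that follows `s` if the next job has execution time `e k`. -/
def nextState (s : State) (k : Fin h) : State :=
  τ.stateOf B ((s.phase + 1) % B.Q) s.rem (τ.e k)

/-- The states created by the construction: the states of the first job, and, repeatedly,
all successors of created states, where identical states of the same phase are merged. -/
inductive IsGenerated : State → Prop
  | init (k : Fin h) : IsGenerated (τ.initialState B k)
  | next (s : State) (k : Fin h) : IsGenerated s → IsGenerated (τ.nextState B s k)

/-- The state space of the constructed chain. -/
abbrev ChainState : Type := {s : State // τ.IsGenerated B s}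

/-- The construction terminates, i.e. it creates only finitely many states. -/
def ConstructionTerminates : Prop := Finite (τ.ChainState B)

/-- The transition graph: there is an edge from `s` to `r` if some execution time leads from `s`
to `r`. -/
def Edge (s r : τ.ChainState B) : Prop := ∃ k, τ.nextState B s.1 k = r.1

/-- Every vertex of the transition graph can be reached from every other vertex by a
directed path. -/
def StronglyConnected : Prop :=
  ∀ s r : τ.ChainState B, s ≠ r → Relation.TransGen (τ.Edge B) s r

open Classical in
/-- The (left stochastic) transition matrix: the entry at `r`, `s` is the probability of passing
from `s` to `r`. -/
def transition : Matrix (τ.ChainState B) (τ.ChainState B) ℝ := fun r s =>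
  ∑ k with τ.nextState B s.1 k = r.1, τ.p k

/-- The chain is irreducible: any two (possibly equal) states are reachable from one another in
at least one step by transitions of positive probability. -/
def ChainIrreducible : Prop :=
  ∀ r s : τ.ChainState B,
    Relation.TransGen (fun a b => 0 < τ.transition B b a) r s ∧
    Relation.TransGen (fun a b => 0 < τ.transition B b a) s r

/-- `π` is a stationary probability distribution of the chain. -/
def IsStationary (π : τ.ChainState B → ℝ) : Prop :=
  (∀ s, 0 ≤ π s) ∧ HasSum π 1 ∧ ∀ r, HasSum (fun s => τ.transition B r s * π s) (π r)

/-- The total mass under `π` of the states that indicate a deadline miss. -/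
def missMass (π : τ.ChainState B → ℝ) : ℝ :=
  ∑' s : {s : τ.ChainState B // s.1.miss}, π s.1

/-- All parameters and the provided service are integers. -/
def IntegerData : Prop :=
  (∃ z : ℤ, τ.T = z) ∧ (∃ z : ℤ, τ.D = z) ∧ (∃ z : ℤ, τ.δ = z) ∧ (∀ k, ∃ z : ℤ, τ.e k = z) ∧
    ∀ n, ∀ m : ℤ, (m : ℝ) ∈ Set.Icc 0 τ.T → ∃ z : ℤ, B.β n m = z

end SoftTask

end

/-! The execution is coupled pathwise to the chain. Under greedy first-come-first-serve, all earlier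
jobs act on job `n` through one number, its backlog `w`: past the release, job `n` sees the supply
minus `w`, truncated at zero (`leftover_sub`). Hence a miss means `service n D < w + c n`, and `w`
obeys the recursion defining `rem`. As the supply is `Q`-periodic, driving the chain with the same
execution times reproduces every miss (`missesDeadline_iff_trajectory`).

For integer data, remaining times are integers in a bounded interval, so only finitely many states
arise.

The ergodic part needs no aperiodicity. The indicator of the next state minus its transition
probability is a bounded martingale difference; these are orthogonal, so their averages vanish
almost surely (`ae_tendsto_average_of_orthogonal`). By telescoping, the empirical frequencies `v N`
satisfy `P (v N) - v N → 0`. They lie in a compact simplex, so cluster points exist and are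
stationary; irreducibility allows only one stationary vector (`fixed_probability_unique`). Thus `v N
→ π`, and the miss rate is a continuous function of `v N`. -/

noncomputable section

/-! ### Arithmetic of the accumulated supply -/

namespace SupplyFunctions

variable {T : ℝ} (B : SupplyFunctions T)

lemma service_zero (n : ℕ) : B.service n 0 = 0 := by
  simp [service, B.zero]

lemma residue_mem {T : ℝ} (hT : 0 < T) {t : ℝ} (ht : 0 ≤ t) : t - T * ⌊t / T⌋₊ ∈ Set.Icc 0 T := by
  have h1 := Nat.floor_le (div_nonneg ht hT.le)
  have h2 := Nat.lt_floor_add_one (t / T)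
  rw [le_div_iff₀ hT] at h1
  rw [div_lt_iff₀ hT] at h2
  constructor <;> nlinarith

lemma floor_add_period (hT : 0 < T) (n : ℕ) {t : ℝ} (ht : 0 ≤ t) :
    ⌊(n * T + t) / T⌋₊ = n + ⌊t / T⌋₊ := by
  rw [add_div, mul_div_cancel_right₀ _ hT.ne', add_comm, Nat.floor_add_natCast
    (div_nonneg ht hT.le), add_comm]

/-- Supply accumulated from period `m` on splits at the beginning of period `m + n`. -/
lemma service_add (hT : 0 < T) (m n : ℕ) {t : ℝ} (ht : 0 ≤ t) :
    B.service m (n * T + t) =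
      (∑ l ∈ Finset.Ico m (m + n), B.β l T) + B.service (m + n) t := by
  unfold service
  rw [floor_add_period hT n ht, ← add_assoc m n,
    ← Finset.sum_Ico_consecutive _ (Nat.le_add_right m n) (Nat.le_add_right (m + n) _)]
  have : (n : ℝ) * T + t - T * ((n + ⌊t / T⌋₊ : ℕ) : ℝ) = t - T * ⌊t / T⌋₊ := by
    push_cast; ring
  rw [this, add_assoc]

lemma service_period_add (hT : 0 < T) (n : ℕ) {t : ℝ} (ht : 0 ≤ t) :
    B.service n (T + t) = B.β n T + B.service (n + 1) t := by
  have := B.service_add hT n 1 ht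
  simpa using this

lemma service_period (hT : 0 < T) (n : ℕ) : B.service n T = B.β n T := by
  have := B.service_period_add hT n le_rfl
  rwa [add_zero, B.service_zero, add_zero] at this

lemma β_nonneg (hT : 0 < T) (n : ℕ) {t : ℝ} (ht : t ∈ Set.Icc 0 T) : 0 ≤ B.β n t := by
  rw [← B.zero n]
  exact B.mono n ⟨le_rfl, hT.le⟩ ht ht.1

lemma service_monotoneOn (hT : 0 < T) (n : ℕ) : MonotoneOn (B.service n) (Set.Ici 0) := by
  intro s hs t ht hst
  have hs : 0 ≤ s := hs
  have ht : 0 ≤ t := ht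
  have hfl : ⌊s / T⌋₊ ≤ ⌊t / T⌋₊ := Nat.floor_le_floor (by gcongr)
  rcases hfl.eq_or_lt with h | h
  · unfold service
    rw [h]
    have h1 := residue_mem hT hs
    have h2 := residue_mem hT ht
    rw [h] at h1
    have := B.mono (n + ⌊t / T⌋₊) h1 h2 (by linarith)
    linarith
  · unfold service
    have h1 := residue_mem hT hs
    have h2 := B.mono (n + ⌊s / T⌋₊) h1 ⟨hT.le, le_rfl⟩ h1.2
    have h3 : ∑ l ∈ Finset.Ico n (n + ⌊s / T⌋₊ + 1), B.β l T ≤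
        ∑ l ∈ Finset.Ico n (n + ⌊t / T⌋₊), B.β l T := by
      apply Finset.sum_le_sum_of_subset_of_nonneg
      · apply Finset.Ico_subset_Ico le_rfl; omega
      · intro i _ _
        exact B.β_nonneg hT i ⟨hT.le, le_rfl⟩
    rw [Finset.sum_Ico_succ_top (by omega)] at h3
    have h4 := B.β_nonneg hT (n + ⌊t / T⌋₊) (residue_mem hT ht)
    linarith

lemma service_nonneg (hT : 0 < T) (n : ℕ) {t : ℝ} (ht : 0 ≤ t) : 0 ≤ B.service n t := by
  rw [← B.service_zero n]
  exact B.service_monotoneOn hT n Set.self_mem_Ici ht ht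

lemma β_mod (n : ℕ) {t : ℝ} (ht : t ∈ Set.Icc 0 T) : B.β (n % B.Q) t = B.β n t := by
  conv_rhs => rw [← Nat.mod_add_div n B.Q]
  generalize n / B.Q = k
  induction k with
  | zero => simp
  | succ k ih => rw [ih, Nat.mul_succ, ← add_assoc, B.periodic _ t ht]

lemma service_mod (hT : 0 < T) (n : ℕ) {t : ℝ} (ht : 0 ≤ t) :
    B.service (n % B.Q) t = B.service n t := by
  have key : ∀ i, ∀ x ∈ Set.Icc 0 T, B.β (n % B.Q + i) x = B.β (n + i) x := by
    intro i x hx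
    rw [← B.β_mod _ hx, ← B.β_mod (n + i) hx, Nat.mod_add_mod]
  unfold service
  rw [key _ _ (residue_mem hT ht), Finset.sum_Ico_eq_sum_range, Finset.sum_Ico_eq_sum_range]
  simp only [Nat.add_sub_cancel_left]
  congr 1
  exact Finset.sum_congr rfl fun i _ => key i T ⟨hT.le, le_rfl⟩

end SupplyFunctions

/-! ### Backlog recursion and coupling with the chain -/

namespace SoftTask

variable {h : ℕ} (τ : SoftTask h) (B : SupplyFunctions τ.T)

/-- The remaining execution time which the predecessors of job `n` leave for the time after its
release, when job `i` has execution time `c i`. -/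
def backlog (c : ℕ → ℝ) : ℕ → ℝ
  | 0 => 0
  | n + 1 => (τ.stateOf B n (backlog c n) (c n)).rem

lemma span_nonneg : 0 ≤ τ.D + τ.δ := add_nonneg τ.D_pos.le τ.δ_nonneg

lemma backlog_nonneg (c : ℕ → ℝ) (n : ℕ) : 0 ≤ τ.backlog B c n := by
  cases n with
  | zero => exact le_rfl
  | succ n => exact le_max_right _ _

/-- The predecessor is dismissed one period before job `n`, so its claim on the supply is exhausted
by the dismiss point of job `n`. -/
lemma backlog_le_service (c : ℕ → ℝ) (n : ℕ) :
    τ.backlog B c n ≤ B.service n (τ.D + τ.δ) := by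
  cases n with
  | zero => exact B.service_nonneg τ.T_pos 0 τ.span_nonneg
  | succ n =>
    have h0 := B.service_nonneg τ.T_pos (n + 1) τ.span_nonneg
    have h1 := B.service_monotoneOn τ.T_pos n (a := τ.D + τ.δ) (b := τ.T + (τ.D + τ.δ))
      τ.span_nonneg (add_nonneg τ.T_pos.le τ.span_nonneg) (by linarith [τ.T_pos])
    rw [B.service_period_add τ.T_pos n τ.span_nonneg] at h1
    refine max_le ?_ h0
    have := min_le_right (τ.backlog B c n + c n) (B.service n (τ.D + τ.δ))
    linarith

/-- After its release, job `n` gets what is supplied beyond the backlog of its predecessors. -/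
lemma leftover_sub (c : ℕ → ℝ) (hc : ∀ n, 0 ≤ c n) (n : ℕ) {t : ℝ} (ht : 0 ≤ t) :
    τ.leftover B c n (τ.release n + t) - τ.leftover B c n (τ.release n) =
      max (B.service n t - τ.backlog B c n) 0 := by
  induction n generalizing t with
  | zero =>
    have := B.service_nonneg τ.T_pos 0 ht
    simp [leftover, release, backlog, B.service_zero, this]
  | succ n ih =>
    have hT := τ.T_pos
    set r := τ.release n with hr
    have hr' : τ.release (n + 1) = r + τ.T := by simp [hr, release]; ring
    have hd : τ.dismissPoint n = r + (τ.D + τ.δ) := by simp [dismissPoint, hr]; ring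
    have hsp := τ.span_nonneg
    set E := B.service n (τ.D + τ.δ) with hE
    set w := τ.backlog B c n with hw
    have hwE : w ≤ E := τ.backlog_le_service B c n
    have hw0 : 0 ≤ w := τ.backlog_nonneg B c n
    have hmin : ∀ x, 0 ≤ x → B.service n (min x (τ.D + τ.δ)) = min (B.service n x) E := by
      intro x hx
      exact (B.service_monotoneOn hT n).map_min hx hsp
    -- Of the supply after `r`, the first `w` goes to predecessors and the next `c n` to job `n`,
    -- but nothing beyond `E`, where job `n` is dismissed; `hwE` makes the two cuts combine into
    -- `min (w + c n) E`.
    have step : ∀ x, 0 ≤ x → τ.leftover B c (n + 1) (r + x) =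
        τ.leftover B c n r + max (B.service n x - min (w + c n) E) 0 := by
      intro x hx
      simp only [leftover, greedyService]
      rw [← hr, hd, min_add_add_left, min_eq_right (by linarith : r ≤ r + x), ih (le_min hx hsp),
        hmin x hx]
      have h1 := ih hx
      have h2 := hc n
      generalize B.service n x = s at *
      have : τ.leftover B c n (r + x) = τ.leftover B c n r + max (s - w) 0 := by linarith
      rw [this]
      grind
    rw [hr', add_assoc, step _ (by positivity), step _ hT.le, B.service_period_add hT n ht,
      B.service_period hT]
    have hs := B.service_nonneg hT (n + 1) ht
    simp only [backlog, stateOf]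
    rw [← hw, ← hE]
    generalize B.service (n + 1) t = s at *
    generalize min (w + c n) E = m at *
    grind

/-- Strict positivity matters: a job with `c n = 0` never misses, even if the backlog exceeds the
supply. -/
lemma missesDeadline_iff (c : ℕ → ℝ) (hc : ∀ n, 0 < c n) (n : ℕ) :
    τ.MissesDeadline B c n ↔ B.service n τ.D < τ.backlog B c n + c n := by
  have hD := τ.D_pos
  have hδ := τ.δ_nonneg
  have h1 : min (τ.deadline n) (τ.dismissPoint n) = τ.release n + τ.D := by
    rw [min_eq_left (by simp only [deadline, dismissPoint]; linarith)]
    rfl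
  have h2 : min (τ.deadline n) (τ.release n) = τ.release n :=
    min_eq_right (by simp only [deadline]; linarith)
  unfold MissesDeadline received greedyService
  rw [h1, h2, τ.leftover_sub B c (fun n => (hc n).le) n hD.le]
  have := hc n
  generalize B.service n τ.D = s at *
  grind

lemma stateOf_mod (n : ℕ) (w x : ℝ) :
    τ.stateOf B (n % B.Q) w x = { τ.stateOf B n w x with phase := n % B.Q } := by
  have hT := τ.T_pos
  simp only [stateOf]
  rw [B.service_mod hT n τ.D_pos.le, B.service_mod hT n τ.span_nonneg,
    B.β_mod n ⟨hT.le, le_rfl⟩]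

/-- The trajectory of the constructed chain when job `n` has execution time `e (κ n)`. -/
def trajectory (κ : ℕ → Fin h) : ℕ → τ.ChainState B
  | 0 => ⟨τ.initialState B (κ 0), .init _⟩
  | n + 1 => ⟨τ.nextState B (trajectory κ n).1 (κ (n + 1)), .next _ _ (trajectory κ n).2⟩

/-- The backlog recursion uses the true job number and the chain its residue; periodicity of the
supply makes them agree. -/
lemma trajectory_eq (κ : ℕ → Fin h) (n : ℕ) :
    (τ.trajectory B κ n).1 =
      τ.stateOf B (n % B.Q) (τ.backlog B (fun i => τ.e (κ i)) n) (τ.e (κ n)) := by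
  induction n with
  | zero => simp [trajectory, initialState, backlog]
  | succ n ih =>
    simp only [trajectory, nextState, ih]
    rw [stateOf_mod τ B n]
    simp [backlog, Nat.mod_add_mod]

/-- A job misses its deadline iff the corresponding state of the chain is marked as a miss. -/
lemma missesDeadline_iff_trajectory (κ : ℕ → Fin h) (n : ℕ) :
    τ.MissesDeadline B (fun i => τ.e (κ i)) n ↔ (τ.trajectory B κ n).1.miss := by
  rw [missesDeadline_iff τ B _ (fun i => τ.e_pos _), trajectory_eq, stateOf_mod]
  rfl

lemma trajectory_congr {κ κ' : ℕ → Fin h} {n : ℕ} (hκ : ∀ i ≤ n, κ i = κ' i) :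
    τ.trajectory B κ n = τ.trajectory B κ' n := by
  induction n with
  | zero => simp [trajectory, hκ 0 le_rfl]
  | succ n ih => simp [trajectory, hκ (n + 1) le_rfl, ih fun i hi => hκ i (by omega)]

/-! ### Termination for integer data -/

lemma service_integer (hI : τ.IntegerData B) (n : ℕ) {t : ℝ} (ht : 0 ≤ t)
    (htz : ∃ z : ℤ, t = z) : ∃ z : ℤ, B.service n t = z := by
  obtain ⟨⟨a, ha⟩, -, -, -, hβ⟩ := hI
  obtain ⟨b, hb⟩ := htz
  have h1 : ∀ l, ∃ z : ℤ, B.β l τ.T = z := fun l => by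
    have := hβ l a (by rw [← ha]; exact ⟨τ.T_pos.le, le_rfl⟩)
    rwa [← ha] at this
  choose f hf using h1
  -- The residue is again an integer in `[0, T]`, where the supply is assumed integral.
  have h2 : t - τ.T * ⌊t / τ.T⌋₊ = ((b - a * ⌊t / τ.T⌋₊ : ℤ) : ℝ) := by
    push_cast
    rw [← ha, ← hb]
  have h3 := SupplyFunctions.residue_mem τ.T_pos ht
  rw [h2] at h3
  obtain ⟨g, hg⟩ := hβ (n + ⌊t / τ.T⌋₊) _ h3
  refine ⟨(∑ l ∈ Finset.Ico n (n + ⌊t / τ.T⌋₊), f l) + g, ?_⟩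
  unfold SupplyFunctions.service
  rw [h2, hg]
  push_cast
  simp [hf]

lemma stateOf_rem_integer (hI : τ.IntegerData B) (n : ℕ) {w x : ℝ} (hw : ∃ z : ℤ, w = z)
    (hx : ∃ z : ℤ, x = z) : ∃ z : ℤ, (τ.stateOf B n w x).rem = z := by
  obtain ⟨a, rfl⟩ := hw
  obtain ⟨b, rfl⟩ := hx
  obtain ⟨s, hs⟩ := τ.service_integer B hI n τ.span_nonneg (by
    obtain ⟨-, ⟨d, hd⟩, ⟨d', hd'⟩, -⟩ := hI
    exact ⟨d + d', by rw [hd, hd']; push_cast; rfl⟩)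
  obtain ⟨g, hg⟩ := τ.service_integer B hI n τ.T_pos.le hI.1
  rw [B.service_period τ.T_pos] at hg
  refine ⟨max (min (a + b) s - g) 0, ?_⟩
  simp only [stateOf]
  rw [hs, hg]
  push_cast
  rfl

lemma stateOf_rem_le (n : ℕ) (w x : ℝ) :
    (τ.stateOf B n w x).rem ≤ B.service n (τ.D + τ.δ) := by
  refine max_le ?_ (B.service_nonneg τ.T_pos n τ.span_nonneg)
  have := B.β_nonneg τ.T_pos n (t := τ.T) ⟨τ.T_pos.le, le_rfl⟩
  have := min_le_right (w + x) (B.service n (τ.D + τ.δ))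
  linarith

theorem terminates_of_integerData (hI : τ.IntegerData B) : τ.ConstructionTerminates B := by
  -- Dismissal caps the remaining time in each of the `Q` phases; `M` is a common cap.
  obtain ⟨M, hM⟩ := ((Finset.range B.Q).image fun n => B.service n (τ.D + τ.δ)).bddAbove
  have key : ∀ s, τ.IsGenerated B s →
      s.phase < B.Q ∧ ∃ z : ℤ, z ∈ Set.Icc 0 ⌊M⌋ ∧ s.rem = z := by
    have aux : ∀ n < B.Q, ∀ w : ℝ, (∃ z : ℤ, w = z) → ∀ k, ∃ z : ℤ, z ∈ Set.Icc 0 ⌊M⌋ ∧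
        (τ.stateOf B n w (τ.e k)).rem = z := by
      intro n hn w hw k
      obtain ⟨z, hz⟩ := τ.stateOf_rem_integer B hI n hw (hI.2.2.2.1 k)
      refine ⟨z, ⟨?_, ?_⟩, hz⟩
      · have : (0 : ℝ) ≤ z := hz ▸ le_max_right _ _
        exact_mod_cast this
      · rw [Int.le_floor, ← hz]
        exact (τ.stateOf_rem_le B n w _).trans (hM (by simpa using ⟨n, hn, rfl⟩))
    intro s hs
    induction hs with
    | init k => exact ⟨B.Q_pos, aux 0 B.Q_pos 0 ⟨0, by simp⟩ k⟩
    | next s k _ ih =>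
      obtain ⟨z, -, hz⟩ := ih.2
      exact ⟨Nat.mod_lt _ B.Q_pos, aux _ (Nat.mod_lt _ B.Q_pos) _ ⟨z, hz⟩ k⟩
  have hfin : ((fun x : ℕ × Prop × ℤ => State.mk x.1 x.2.1 (x.2.2 : ℝ)) ''
      (Set.Iio B.Q ×ˢ (Set.univ ×ˢ Set.Icc 0 ⌊M⌋))).Finite :=
    ((Set.finite_Iio _).prod (Set.finite_univ.prod (Set.finite_Icc _ _))).image _
  refine Set.Finite.to_subtype (s := {s | τ.IsGenerated B s}) (hfin.subset fun s hs => ?_)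
  obtain ⟨h1, z, h2, h3⟩ := key s hs
  exact ⟨(s.phase, s.miss, z), ⟨h1, trivial, h2⟩, by ext <;> simp [h3]⟩

end SoftTask
end

noncomputable section

/-! ### Uniqueness of fixed probability vectors -/

section StationaryUniqueness

variable {S : Type*} [Fintype S] {P : Matrix S S ℝ}

/-- A nonnegative fixed vector of an irreducible nonnegative matrix with a zero entry vanishes. -/
lemma eq_zero_of_fixed_of_apply_eq_zero (hP : ∀ r s, 0 ≤ P r s)
    (hirr : ∀ r s, Relation.TransGen (fun a b => 0 < P b a) r s) {ν : S → ℝ} (hν : ∀ s, 0 ≤ ν s)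
    (hfix : ∀ r, ∑ s, P r s * ν s = ν r) {r : S} (hr : ν r = 0) : ν = 0 := by
  -- A vanishing sum of nonnegative terms: zeros spread backwards along transitions.
  have hstep : ∀ a b, 0 < P b a → ν b = 0 → ν a = 0 := by
    intro a b hab hb
    have h1 := (Finset.sum_eq_zero_iff_of_nonneg
      fun s _ => mul_nonneg (hP b s) (hν s)).1 ((hfix b).trans hb) a (Finset.mem_univ a)
    exact (mul_eq_zero.1 h1).resolve_left hab.ne'
  funext s
  refine Relation.TransGen.head_induction_on (motive := fun a _ => ν a = 0) (hirr s r) ?_ ?_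
  · exact fun h => hstep _ _ h hr
  · exact fun h _ ih => hstep _ _ h ih

/-- An irreducible nonnegative matrix has at most one fixed probability vector. -/
lemma fixed_probability_unique [Nonempty S] (hP : ∀ r s, 0 ≤ P r s)
    (hirr : ∀ r s, Relation.TransGen (fun a b => 0 < P b a) r s) {π π' : S → ℝ}
    (hπ : ∀ s, 0 ≤ π s) (hπ1 : ∑ s, π s = 1) (hfix : ∀ r, ∑ s, P r s * π s = π r)
    (hπ1' : ∑ s, π' s = 1) (hfix' : ∀ r, ∑ s, P r s * π' s = π' r) :
    π' = π := by
  have hpos : ∀ s, 0 < π s := by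
    intro s
    refine (hπ s).lt_of_ne fun h0 => ?_
    have := eq_zero_of_fixed_of_apply_eq_zero hP hirr hπ hfix h0.symm
    simp [this] at hπ1
  -- With the minimal ratio `t`, the fixed vector `π' - t π` is nonnegative and vanishes at `r`.
  obtain ⟨r, hr⟩ := Finite.exists_min fun s => π' s / π s
  set t := π' r / π r with ht
  have hzero : (fun s => π' s - t * π s) = 0 := by
    refine eq_zero_of_fixed_of_apply_eq_zero hP hirr (r := r) ?_ ?_ ?_
    · intro s
      have := (le_div_iff₀ (hpos s)).1 (hr s)
      linarith
    · intro q
      simp only [mul_sub, Finset.sum_sub_distrib, hfix']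
      rw [← hfix q, Finset.mul_sum]
      simp only [mul_left_comm]
    · rw [ht, div_mul_cancel₀ _ (hpos r).ne', sub_self]
  have hmul : ∀ s, π' s = t * π s := fun s => sub_eq_zero.1 (congrFun hzero s)
  have ht1 : t = 1 := by
    simp only [hmul, ← Finset.mul_sum, hπ1, mul_one] at hπ1'
    exact hπ1'
  funext s
  rw [hmul, ht1, one_mul]

end StationaryUniqueness

/-! ### A strong law for bounded orthogonal variables -/

/-- Averages of a sequence bounded by `1` tend to `0` if they do so along the squares. -/
lemma tendsto_average_of_tendsto_squares {d : ℕ → ℝ} (hd : ∀ n, |d n| ≤ 1)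
    (hsq : Tendsto (fun k : ℕ => (∑ n ∈ Finset.range ((k + 1) ^ 2), d n) / ((k + 1 : ℕ) : ℝ) ^ 2)
      atTop (𝓝 0)) :
    Tendsto (fun N : ℕ => (∑ n ∈ Finset.range N, d n) / (N : ℝ)) atTop (𝓝 0) := by
  have hroot : Tendsto (fun N : ℕ => Nat.sqrt N - 1) atTop atTop := by
    refine tendsto_atTop.2 fun b => ?_
    filter_upwards [eventually_ge_atTop ((b + 1) ^ 2)] with N hN
    have : b + 1 ≤ Nat.sqrt N := Nat.le_sqrt'.2 hN
    omega
  have h2 : Tendsto (fun k : ℕ => 2 / ((k : ℝ) + 1)) atTop (𝓝 0) :=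
    (tendsto_const_nhds (x := (2 : ℝ))).div_atTop
      (tendsto_atTop_add_const_right _ _ tendsto_natCast_atTop_atTop)
  have hb := (hsq.abs.add h2).comp hroot
  rw [abs_zero, zero_add] at hb
  refine squeeze_zero_norm' ?_ hb
  filter_upwards [eventually_ge_atTop 1] with N hN
  obtain ⟨k, hk⟩ : ∃ k, Nat.sqrt N = k + 1 :=
    ⟨Nat.sqrt N - 1, by have := Nat.sqrt_pos.2 hN; omega⟩
  have hle : (k + 1) ^ 2 ≤ N := hk ▸ Nat.sqrt_le' N
  have hlt : N < (k + 2) ^ 2 := by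
    have := Nat.lt_succ_sqrt' N
    rwa [hk] at this
  simp only [Function.comp, hk, Nat.add_sub_cancel, Real.norm_eq_abs]
  have hK : (0 : ℝ) < (k : ℝ) + 1 := by positivity
  -- Fewer than `2 (k + 1) + 1` terms lie between the square `(k + 1) ^ 2` and `N`.
  have hdiff : |∑ n ∈ Finset.range N, d n| ≤
      |∑ n ∈ Finset.range ((k + 1) ^ 2), d n| + 2 * (k + 1) := by
    rw [← Finset.sum_range_add_sum_Ico d hle]
    refine (abs_add_le _ _).trans (add_le_add le_rfl ?_)
    refine (Finset.abs_sum_le_sum_abs _ _).trans ((Finset.sum_le_sum fun n _ => hd n).trans ?_)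
    simp only [Finset.sum_const, Nat.card_Ico, nsmul_eq_mul, mul_one]
    have : N - (k + 1) ^ 2 ≤ 2 * (k + 1) := by
      have : (k + 2) ^ 2 = (k + 1) ^ 2 + 2 * (k + 1) + 1 := by ring
      omega
    exact_mod_cast this
  have hN' : ((k : ℝ) + 1) ^ 2 ≤ N := by exact_mod_cast hle
  have hN0 : (0 : ℝ) < N := lt_of_lt_of_le (by positivity) hN'
  rw [abs_div, abs_div, abs_of_pos hN0, Nat.cast_add, Nat.cast_one, abs_of_pos (pow_pos hK 2)]
  calc |∑ n ∈ Finset.range N, d n| / N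
      ≤ (|∑ n ∈ Finset.range ((k + 1) ^ 2), d n| + 2 * (k + 1)) / ((k : ℝ) + 1) ^ 2 := by
        gcongr
    _ = _ := by field_simp

/-- Strong law of large numbers for bounded, pairwise orthogonal random variables. -/
lemma ae_tendsto_average_of_orthogonal {Ω : Type*} [MeasurableSpace Ω] {μ : Measure Ω}
    [IsProbabilityMeasure μ] {d : ℕ → Ω → ℝ} (hm : ∀ n, Measurable (d n))
    (hd : ∀ n ω, |d n ω| ≤ 1) (horth : ∀ m n, m < n → ∫ ω, d m ω * d n ω ∂μ = 0) :
    ∀ᵐ ω ∂μ, Tendsto (fun N : ℕ => (∑ n ∈ Finset.range N, d n ω) / (N : ℝ)) atTop (𝓝 0) := by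
  have hprod : ∀ m n ω, |d m ω * d n ω| ≤ 1 := fun m n ω => by
    rw [abs_mul]
    exact mul_le_one₀ (hd m ω) (abs_nonneg _) (hd n ω)
  have hint : ∀ m n, Integrable (fun ω => d m ω * d n ω) μ := fun m n =>
    Integrable.of_bound ((hm m).mul (hm n)).aestronglyMeasurable 1
      (Eventually.of_forall fun ω => hprod m n ω)
  have hsum : ∀ N : ℕ, ∫ ω, (∑ n ∈ Finset.range N, d n ω) ^ 2 ∂μ ≤ N := by
    intro N
    simp only [sq, Finset.sum_mul_sum]
    rw [integral_finsetSum _ fun m _ => integrable_finsetSum _ fun n _ => hint m n]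
    have h1 : ∀ m ∈ Finset.range N,
        ∫ ω, ∑ n ∈ Finset.range N, d m ω * d n ω ∂μ ≤ 1 := by
      intro m hmN
      rw [integral_finsetSum _ fun n _ => hint m n, Finset.sum_eq_single_of_mem m hmN]
      · calc ∫ ω, d m ω * d m ω ∂μ ≤ ∫ _, (1 : ℝ) ∂μ :=
              integral_mono (hint m m) (integrable_const _) fun ω =>
                (le_abs_self _).trans (hprod m m ω)
          _ = 1 := by simp
      · intro n _ hne
        rcases lt_or_gt_of_ne hne with h | h
        · simpa only [mul_comm] using horth n m h
        · exact horth m n h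
    simpa using Finset.sum_le_sum h1
  have hsqint : ∀ N : ℕ, Integrable (fun ω => (∑ n ∈ Finset.range N, d n ω) ^ 2) μ := by
    intro N
    simp only [sq, Finset.sum_mul_sum]
    exact integrable_finsetSum _ fun m _ => integrable_finsetSum _ fun n _ => hint m n
  set g : ℕ → Ω → ℝ := fun k ω =>
    (∑ n ∈ Finset.range ((k + 1) ^ 2), d n ω) / ((k + 1 : ℕ) : ℝ) ^ 2 with hg
  have hgm : ∀ k, Measurable (g k) := fun k =>
    (Finset.measurable_fun_sum _ fun n _ => hm n).div_const _
  have hgint : ∀ k, ∫⁻ ω, ENNReal.ofReal (g k ω ^ 2) ∂μ ≤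
      ENNReal.ofReal (1 / ((k + 1 : ℕ) : ℝ) ^ 2) := by
    intro k
    have hi : Integrable (fun ω => g k ω ^ 2) μ := by
      simp only [hg, div_pow]
      exact (hsqint _).div_const _
    rw [← ofReal_integral_eq_lintegral_ofReal hi (Eventually.of_forall fun ω => sq_nonneg _)]
    refine ENNReal.ofReal_le_ofReal ?_
    simp only [hg, div_pow]
    rw [integral_div]
    have h1 := hsum ((k + 1) ^ 2)
    have hK : (0 : ℝ) < ((k + 1 : ℕ) : ℝ) := by positivity
    rw [div_le_div_iff₀ (by positivity) (by positivity)]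
    rw [Nat.cast_pow] at h1
    nlinarith [pow_pos hK 2]
  -- Along squares the second moments are at most `1 / (k + 1) ^ 2`, hence summable, so `g k ω ^ 2`
  -- is almost surely summable.
  have hfin : ∫⁻ ω, ∑' k, ENNReal.ofReal (g k ω ^ 2) ∂μ ≠ ⊤ := by
    rw [lintegral_tsum fun k => ((hgm k).pow_const 2).ennreal_ofReal.aemeasurable]
    have hs : Summable fun k : ℕ => 1 / ((k + 1 : ℕ) : ℝ) ^ 2 :=
      (summable_nat_add_iff 1).2 (Real.summable_one_div_nat_pow.2 one_lt_two)
    refine ne_top_of_le_ne_top ?_ (ENNReal.tsum_le_tsum hgint)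
    rw [← ENNReal.ofReal_tsum_of_nonneg (fun k => by positivity) hs]
    exact ENNReal.ofReal_ne_top
  filter_upwards [ae_lt_top' (AEMeasurable.tsum
    fun k => ((hgm k).pow_const 2).ennreal_ofReal.aemeasurable) hfin] with ω hω
  refine tendsto_average_of_tendsto_squares (fun n => hd n ω) ?_
  have h0 := ENNReal.tendsto_atTop_zero_of_tsum_ne_top hω.ne
  have h1 := (ENNReal.tendsto_toReal ENNReal.zero_ne_top).comp h0
  have h2 : Tendsto (fun k => g k ω ^ 2) atTop (𝓝 0) := by
    refine h1.congr fun k => ?_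
    exact ENNReal.toReal_ofReal (sq_nonneg _)
  have h3 := h2.sqrt
  simp only [Real.sqrt_sq_eq_abs, Real.sqrt_zero] at h3
  exact (tendsto_zero_iff_abs_tendsto_zero _).2 h3

end

noncomputable section
namespace SoftTask

variable {h : ℕ} (τ : SoftTask h) (B : SupplyFunctions τ.T)

lemma nonempty_index (τ : SoftTask h) : Nonempty (Fin h) := by
  by_contra hne
  rw [not_nonempty_iff] at hne
  have := τ.p_sum
  simp at this

/-! ### Irreducibility -/

/-- The successor of a state of the chain. -/
def successor (s : τ.ChainState B) (k : Fin h) : τ.ChainState B :=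
  ⟨τ.nextState B s.1 k, .next _ _ s.2⟩

open Classical in
lemma transition_eq (r s : τ.ChainState B) :
    τ.transition B r s = ∑ k, τ.p k * if τ.successor B s k = r then 1 else 0 := by
  simp only [transition, successor, Finset.sum_filter, Subtype.ext_iff, mul_ite, mul_one, mul_zero]

lemma transition_nonneg (r s : τ.ChainState B) : 0 ≤ τ.transition B r s :=
  Finset.sum_nonneg fun k _ => (τ.p_pos k).le

lemma transition_le_one (r s : τ.ChainState B) : τ.transition B r s ≤ 1 := by
  classical
  rw [← τ.p_sum, transition]
  exact Finset.sum_le_sum_of_subset_of_nonneg (Finset.subset_univ _) fun k _ _ => (τ.p_pos k).le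

lemma transition_pos_of_edge {s r : τ.ChainState B} (hsr : τ.Edge B s r) :
    0 < τ.transition B r s := by
  classical
  obtain ⟨k, hk⟩ := hsr
  exact Finset.sum_pos (fun k _ => τ.p_pos k) ⟨k, by simpa using hk⟩

lemma chainIrreducible_of_stronglyConnected (hS : τ.StronglyConnected B) :
    τ.ChainIrreducible B := by
  have main : ∀ s r : τ.ChainState B, Relation.TransGen (τ.Edge B) s r := by
    intro s r
    -- Strong connectivity is silent about equal states: leave `s` by any edge and return.
    by_cases hsr : s = r
    · subst hsr
      obtain ⟨k⟩ := τ.nonempty_index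
      have hedge : τ.Edge B s (τ.successor B s k) := ⟨k, rfl⟩
      by_cases hk : τ.successor B s k = s
      · rw [hk] at hedge
        exact .single hedge
      · exact .head hedge (hS _ _ hk)
    · exact hS s r hsr
  have mono : ∀ s r : τ.ChainState B,
      Relation.TransGen (fun a b => 0 < τ.transition B b a) s r := fun s r =>
    (main s r).lift id fun _ _ => τ.transition_pos_of_edge B
  exact fun r s => ⟨mono r s, mono s r⟩

/-! ### The execution times as random indices -/

variable {Ω : Type*} [MeasurableSpace Ω] {μ : Measure Ω} {C : ℕ → Ω → ℝ}

/-- The index of an execution time. -/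
def index [Nonempty (Fin h)] : ℝ → Fin h := Function.invFun τ.e

/-- Off the finite range of `e`, `Function.invFun` takes a single default value. -/
lemma measurable_index [Nonempty (Fin h)] : Measurable τ.index := by
  have hr : MeasurableSet (Set.range τ.e) := (Set.finite_range _).measurableSet
  refine measurable_to_countable' fun k => ?_
  have : τ.index ⁻¹' {k} = (τ.index ⁻¹' {k} ∩ Set.range τ.e) ∪
      (τ.index ⁻¹' {k} ∩ (Set.range τ.e)ᶜ) := (Set.inter_union_compl _ _).symm
  rw [this]
  refine MeasurableSet.union ((Set.finite_range τ.e).subset Set.inter_subset_right).measurableSet ?_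
  by_cases hk : Classical.choice ‹Nonempty (Fin h)› = k
  · convert hr.compl using 1
    refine Set.inter_eq_right.2 fun x hx => ?_
    have := Function.invFun_neg (f := τ.e) (b := x) (by simpa using hx)
    exact this.trans hk
  · convert MeasurableSet.empty using 1
    refine Set.eq_empty_of_forall_notMem fun x hx => hk ?_
    have := Function.invFun_neg (f := τ.e) (b := x) (by simpa using hx.2)
    exact this.symm.trans hx.1

/-- Factoring through a finite discrete space makes measurability automatic and lets block
independence apply. -/
lemma exists_factor_of_dependsOn [Nonempty (Fin h)] {α : Type*} {F : (ℕ → Fin h) → α} {n : ℕ}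
    (hF : ∀ κ κ' : ℕ → Fin h, (∀ i ≤ n, κ i = κ' i) → F κ = F κ') :
    ∃ G : (Finset.range (n + 1) → Fin h) → α, ∀ κ, F κ = G fun i => κ i := by
  refine ⟨fun x => F fun i => if hi : i ∈ Finset.range (n + 1) then x ⟨i, hi⟩ else
    Classical.arbitrary _, fun κ => hF _ _ fun i hi => ?_⟩
  simp [hi]

lemma measurable_of_dependsOn [Nonempty (Fin h)] (hC : τ.IsExecutionTimes μ C)
    {F : (ℕ → Fin h) → ℝ} {n : ℕ}
    (hF : ∀ κ κ' : ℕ → Fin h, (∀ i ≤ n, κ i = κ' i) → F κ = F κ') :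
    Measurable fun ω => F fun i => τ.index (C i ω) := by
  obtain ⟨G, hG⟩ := exists_factor_of_dependsOn hF
  simp only [hG]
  exact (Measurable.of_discrete (f := G)).comp
    (measurable_pi_lambda _ fun i => τ.measurable_index.comp (hC.1 i))

variable [IsProbabilityMeasure μ]

lemma ae_eq_index [Nonempty (Fin h)] (hC : τ.IsExecutionTimes μ C) :
    ∀ᵐ ω ∂μ, ∀ n, C n ω = τ.e (τ.index (C n ω)) := by
  rw [ae_all_iff]
  intro n
  have hm : MeasurableSet {ω | C n ω ∈ Set.range τ.e} :=
    hC.1 n (Set.finite_range τ.e).measurableSet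
  have hU : {ω | C n ω ∈ Set.range τ.e} = ⋃ k, {ω | C n ω = τ.e k} := by
    ext ω; simp [eq_comm]
  have h1 : μ {ω | C n ω ∈ Set.range τ.e} = 1 := by
    rw [hU, measure_iUnion, tsum_fintype]
    · simp only [hC.2.2]
      rw [← ENNReal.ofReal_sum_of_nonneg fun k _ => (τ.p_pos k).le, τ.p_sum, ENNReal.ofReal_one]
    · intro i j hij
      refine Set.disjoint_left.2 fun ω hi hj => hij (τ.e_strictMono.injective ?_)
      exact hi.symm.trans hj
    · exact fun k => hC.1 n (measurableSet_singleton _)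
  have h2 : ∀ᵐ ω ∂μ, C n ω ∈ Set.range τ.e := (prob_compl_eq_zero_iff hm).2 h1
  filter_upwards [h2] with ω hω
  exact (Function.invFun_eq hω).symm

lemma measure_index [Nonempty (Fin h)] (hC : τ.IsExecutionTimes μ C) (n : ℕ) (k : Fin h) :
    μ.real {ω | τ.index (C n ω) = k} = τ.p k := by
  have : μ {ω | τ.index (C n ω) = k} = μ {ω | C n ω = τ.e k} := by
    refine measure_congr ?_
    filter_upwards [τ.ae_eq_index hC] with ω hω
    refine propext ⟨fun hk => ?_, fun hk => ?_⟩
    · have hk' : τ.index (C n ω) = k := hk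
      exact (hω n).trans (by rw [hk'])
    · have hk' : C n ω = τ.e k := hk
      exact τ.e_strictMono.injective ((hω n).symm.trans hk')
  rw [Measure.real, this, hC.2.2, ENNReal.toReal_ofReal (τ.p_pos k).le]

lemma integral_index [Nonempty (Fin h)] (hC : τ.IsExecutionTimes μ C) (n : ℕ) (f : Fin h → ℝ) :
    ∫ ω, f (τ.index (C n ω)) ∂μ = ∑ k, τ.p k * f k := by
  have hm : Measurable fun ω => τ.index (C n ω) := τ.measurable_index.comp (hC.1 n)
  rw [← integral_map (φ := fun ω => τ.index (C n ω)) hm.aemeasurable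
    (Measurable.of_discrete (f := f)).aestronglyMeasurable]
  have := Measure.isProbabilityMeasure_map (μ := μ) hm.aemeasurable
  rw [integral_fintype (Integrable.of_finite)]
  refine Finset.sum_congr rfl fun k _ => ?_
  rw [map_measureReal_apply hm (measurableSet_singleton k), smul_eq_mul, ← τ.measure_index hC n k]
  rfl

/-! ### Empirical distribution of the trajectory -/

open Classical in
/-- The deviation of the `n`-th transition to `r` from its conditional expectation. -/
def deviation (r : τ.ChainState B) (κ : ℕ → Fin h) (n : ℕ) : ℝ :=
  (if τ.trajectory B κ (n + 1) = r then 1 else 0) - τ.transition B r (τ.trajectory B κ n)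

lemma abs_deviation_le (r : τ.ChainState B) (κ : ℕ → Fin h) (n : ℕ) :
    |τ.deviation B r κ n| ≤ 1 := by
  have h0 := τ.transition_nonneg B r (τ.trajectory B κ n)
  have h1 := τ.transition_le_one B r (τ.trajectory B κ n)
  unfold deviation
  rw [abs_le]
  split_ifs <;> constructor <;> linarith

/-- The past of the trajectory is uncorrelated with any function of the next index. -/
lemma integral_past_mul_next [Nonempty (Fin h)] (hC : τ.IsExecutionTimes μ C)
    {F : (ℕ → Fin h) → ℝ} {n : ℕ}
    (hF : ∀ κ κ' : ℕ → Fin h, (∀ i ≤ n, κ i = κ' i) → F κ = F κ') (f : Fin h → ℝ) :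
    ∫ ω, F (fun i => τ.index (C i ω)) * f (τ.index (C (n + 1) ω)) ∂μ =
      (∫ ω, F (fun i => τ.index (C i ω)) ∂μ) * ∑ k, τ.p k * f k := by
  have hm : ∀ i, Measurable fun ω => τ.index (C i ω) := fun i => τ.measurable_index.comp (hC.1 i)
  have hind : iIndepFun (fun i ω => τ.index (C i ω)) μ :=
    hC.2.1.comp (fun _ => τ.index) fun _ => τ.measurable_index
  have hpair := hind.indepFun_finset (Finset.range (n + 1)) {n + 1} (by simp) hm
  obtain ⟨G, hG⟩ := exists_factor_of_dependsOn hF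
  have hpair' := hpair.comp
    (φ := G)
    (ψ := fun x => f (x ⟨n + 1, Finset.mem_singleton_self _⟩))
    Measurable.of_discrete Measurable.of_discrete
  rw [← τ.integral_index hC (n + 1) f]
  simp only [hG]
  refine hpair'.integral_fun_mul_eq_mul_integral ?_ ?_
  · exact ((Measurable.of_discrete (f := G)).comp
      (measurable_pi_lambda _ fun i => hm i)).aestronglyMeasurable
  · exact ((Measurable.of_discrete (f := f)).comp (hm _)).aestronglyMeasurable

lemma deviation_dependsOn (r : τ.ChainState B) (n : ℕ) (κ κ' : ℕ → Fin h)
    (hκ : ∀ i ≤ n + 1, κ i = κ' i) : τ.deviation B r κ n = τ.deviation B r κ' n := by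
  unfold deviation
  rw [τ.trajectory_congr B hκ, τ.trajectory_congr B fun i (hi : i ≤ n) => hκ i (by omega)]

/-- Split by the state `s` at time `n`: given `s`, the later deviation is a centred function `f s`
of the fresh index `n + 1`, independent of the factor `F s` from the past. -/
lemma integral_deviation_mul [Nonempty (Fin h)] [Finite (τ.ChainState B)]
    (hC : τ.IsExecutionTimes μ C) (r : τ.ChainState B) {m n : ℕ} (hmn : m < n) :
    ∫ ω, τ.deviation B r (fun i => τ.index (C i ω)) m *
      τ.deviation B r (fun i => τ.index (C i ω)) n ∂μ = 0 := by
  classical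
  have := Fintype.ofFinite (τ.ChainState B)
  set F : τ.ChainState B → (ℕ → Fin h) → ℝ := fun s κ =>
    τ.deviation B r κ m * if τ.trajectory B κ n = s then 1 else 0 with hFdef
  set f : τ.ChainState B → Fin h → ℝ := fun s k =>
    (if τ.successor B s k = r then 1 else 0) - τ.transition B r s with hf
  have hF : ∀ s, ∀ κ κ' : ℕ → Fin h, (∀ i ≤ n, κ i = κ' i) → F s κ = F s κ' := by
    intro s κ κ' hκ
    simp only [hFdef]
    rw [τ.trajectory_congr B hκ, τ.deviation_dependsOn B r m κ κ' fun i hi => hκ i (by omega)]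
  have hsplit : ∀ κ, τ.deviation B r κ m * τ.deviation B r κ n =
      ∑ s, F s κ * f s (κ (n + 1)) := by
    intro κ
    rw [Finset.sum_eq_single (τ.trajectory B κ n)]
    · simp only [hFdef, hf, deviation, trajectory, successor, if_true, mul_one]
      congr!
    · intro s _ hs
      simp [hFdef, hs.symm]
    · simp
  have hf0 : ∀ s, ∑ k, τ.p k * f s k = 0 := by
    intro s
    simp only [hf, mul_sub, Finset.sum_sub_distrib]
    rw [← transition_eq, ← Finset.sum_mul, τ.p_sum, one_mul, sub_self]
  simp_rw [hsplit]
  rw [integral_finsetSum]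
  · refine Finset.sum_eq_zero fun s _ => ?_
    rw [τ.integral_past_mul_next hC (hF s), hf0, mul_zero]
  · intro s _
    refine Integrable.of_bound (C := 1) (Measurable.aestronglyMeasurable ?_)
      (Eventually.of_forall fun ω => ?_)
    · exact (τ.measurable_of_dependsOn hC (hF s)).mul
        ((Measurable.of_discrete (f := f s)).comp (τ.measurable_index.comp (hC.1 _)))
    · have h1 := τ.abs_deviation_le B r (fun i => τ.index (C i ω)) m
      have h2 : |f s (τ.index (C (n + 1) ω))| ≤ 1 := by
        have h0 := τ.transition_nonneg B r s
        have h1 := τ.transition_le_one B r s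
        simp only [hf]
        rw [abs_le]
        split_ifs <;> constructor <;> linarith
      rw [Real.norm_eq_abs, abs_mul]
      refine mul_le_one₀ ?_ (abs_nonneg _) h2
      simp only [hFdef]
      split_ifs <;> simp [h1]

open Classical in
/-- The relative frequency of the states among the first `N` states of the trajectory. -/
def frequency (κ : ℕ → Fin h) (N : ℕ) (s : τ.ChainState B) : ℝ :=
  (∑ n ∈ Finset.range N, if τ.trajectory B κ n = s then 1 else 0) / (N : ℝ)

lemma frequency_mem_stdSimplex [Fintype (τ.ChainState B)] (κ : ℕ → Fin h) {N : ℕ} (hN : 1 ≤ N) :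
    τ.frequency B κ N ∈ stdSimplex ℝ (τ.ChainState B) := by
  classical
  refine ⟨fun s => div_nonneg (Finset.sum_nonneg fun n _ => by split_ifs <;> simp)
    (Nat.cast_nonneg N), ?_⟩
  simp only [frequency]
  rw [← Finset.sum_div, Finset.sum_comm]
  have : (N : ℝ) ≠ 0 := by positivity
  simp [this]

lemma sum_transition_mul_frequency [Fintype (τ.ChainState B)] (κ : ℕ → Fin h) (N : ℕ)
    (r : τ.ChainState B) :
    ∑ s, τ.transition B r s * τ.frequency B κ N s =
      (∑ n ∈ Finset.range N, τ.transition B r (τ.trajectory B κ n)) / N := by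
  classical
  simp only [frequency, mul_div_assoc', Finset.mul_sum]
  rw [← Finset.sum_div, Finset.sum_comm]
  simp

lemma ae_tendsto_frequency_defect [Nonempty (Fin h)] [Fintype (τ.ChainState B)]
    (hC : τ.IsExecutionTimes μ C) :
    ∀ᵐ ω ∂μ, ∀ r, Tendsto (fun N =>
      (∑ s, τ.transition B r s * τ.frequency B (fun i => τ.index (C i ω)) N s) -
        τ.frequency B (fun i => τ.index (C i ω)) N r) atTop (𝓝 0) := by
  classical
  rw [ae_all_iff]
  intro r
  have hlim := ae_tendsto_average_of_orthogonal (μ := μ)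
    (d := fun n ω => τ.deviation B r (fun i => τ.index (C i ω)) n)
    (fun n => τ.measurable_of_dependsOn hC (τ.deviation_dependsOn B r n))
    (fun n ω => τ.abs_deviation_le B r _ n)
    (fun m n hmn => τ.integral_deviation_mul B hC r hmn)
  filter_upwards [hlim] with ω hω
  set κ : ℕ → Fin h := fun i => τ.index (C i ω)
  set ι : ℕ → ℝ := fun n => if τ.trajectory B κ n = r then 1 else 0 with hι
  -- Deviations involve `ι (n + 1)` but frequencies `ι n`; this is the telescoped error of the
  -- shift.
  have hbd : Tendsto (fun N : ℕ => (ι N - ι 0) / (N : ℝ)) atTop (𝓝 0) := by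
    refine squeeze_zero_norm (a := fun N : ℕ => 1 / (N : ℝ)) (fun N => ?_)
      tendsto_one_div_atTop_nhds_zero_nat
    rw [norm_div, Real.norm_natCast, Real.norm_eq_abs]
    gcongr
    simp only [hι]
    split_ifs <;> simp
  have hsum := hbd.sub hω
  rw [sub_zero] at hsum
  refine hsum.congr fun N => ?_
  rw [sum_transition_mul_frequency, frequency, ← sub_div, ← sub_div]
  congr 1
  have htel := Finset.sum_range_sub ι N
  simp only [deviation, Finset.sum_sub_distrib] at htel ⊢
  change _ - (∑ n ∈ Finset.range N, ι (n + 1) - _) = _ - ∑ n ∈ Finset.range N, ι n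
  linarith

/-! ### Stationary distribution and miss rate by compactness -/

lemma isStationary_iff [Fintype (τ.ChainState B)] (π : τ.ChainState B → ℝ) :
    τ.IsStationary B π ↔ (∀ s, 0 ≤ π s) ∧ ∑ s, π s = 1 ∧
      ∀ r, ∑ s, τ.transition B r s * π s = π r := by
  have key : ∀ (f : τ.ChainState B → ℝ) (a : ℝ), HasSum f a ↔ ∑ s, f s = a := fun f a =>
    ⟨fun hs => (hasSum_fintype f).unique hs, fun hs => hs ▸ hasSum_fintype f⟩
  simp only [IsStationary, key]

/-- A cluster point of asymptotically invariant probability vectors is stationary. -/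
lemma isStationary_of_mapClusterPt [Fintype (τ.ChainState B)] {v : ℕ → τ.ChainState B → ℝ}
    (hdef : ∀ r, Tendsto (fun N => (∑ s, τ.transition B r s * v N s) - v N r) atTop (𝓝 0))
    {x : τ.ChainState B → ℝ} (hx : x ∈ stdSimplex ℝ (τ.ChainState B))
    (hcl : MapClusterPt x atTop v) : τ.IsStationary B x := by
  refine (τ.isStationary_iff B x).2 ⟨hx.1, hx.2, fun r => ?_⟩
  have hcont : Continuous fun y : τ.ChainState B → ℝ =>
      (∑ s, τ.transition B r s * y s) - y r := by fun_prop
  have h1 := hcl.continuousAt_comp hcont.continuousAt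
  obtain ⟨U, hU, hUlim⟩ := mapClusterPt_iff_ultrafilter.1 h1
  exact sub_eq_zero.1 (tendsto_nhds_unique hUlim ((hdef r).mono_left hU))

lemma DM_eq (κ : ℕ → Fin h) (n : ℕ) [Decidable (τ.trajectory B κ n).1.miss] :
    τ.DM B (fun i => τ.e (κ i)) n = if (τ.trajectory B κ n).1.miss then 1 else 0 := by
  unfold DM
  simp only [τ.missesDeadline_iff_trajectory B κ n]

open Classical in
lemma missMass_eq_sum [Fintype (τ.ChainState B)] (π : τ.ChainState B → ℝ) :
    τ.missMass B π = ∑ s, if s.1.miss then π s else 0 := by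
  rw [missMass, tsum_fintype, ← Finset.sum_filter]
  exact (Finset.sum_subtype _ (by simp) _).symm

lemma DMRFirst_eq [Fintype (τ.ChainState B)] (κ : ℕ → Fin h) (N : ℕ) :
    τ.DMRFirst B (fun i => τ.e (κ i)) N = τ.missMass B (τ.frequency B κ N) := by
  classical
  rw [missMass_eq_sum, DMRFirst]
  simp only [DM_eq, frequency]
  simp only [← Finset.sum_filter (s := Finset.univ), ← Finset.sum_div]
  rw [Finset.sum_comm, one_div, div_eq_inv_mul]
  congr 1
  refine Finset.sum_congr rfl fun n _ => ?_
  simp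

theorem exists_stationary_and_rate (hC : τ.IsExecutionTimes μ C)
    (hfin : τ.ConstructionTerminates B) (hirr : τ.ChainIrreducible B) :
    ∃ π : τ.ChainState B → ℝ, τ.IsStationary B π ∧
      (∀ π' : τ.ChainState B → ℝ, τ.IsStationary B π' → π' = π) ∧
      τ.IsDeadlineMissRate B μ C (τ.missMass B π) := by
  have : Finite (τ.ChainState B) := hfin
  have := Fintype.ofFinite (τ.ChainState B)
  have := τ.nonempty_index
  have : Nonempty (τ.ChainState B) := ⟨τ.trajectory B (fun _ => Classical.arbitrary _) 0⟩
  have hdef := τ.ae_tendsto_frequency_defect B hC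
  -- Only eventually: at `N = 0` the frequency is `0 / 0 = 0`, outside the simplex.
  have hmem : ∀ κ, ∀ᶠ N in atTop, τ.frequency B κ N ∈ stdSimplex ℝ (τ.ChainState B) := fun κ => by
    filter_upwards [eventually_ge_atTop 1] with N hN
    exact τ.frequency_mem_stdSimplex B κ hN
  have hcompact := isCompact_stdSimplex ℝ (τ.ChainState B)
  obtain ⟨π, hπ⟩ : ∃ π, τ.IsStationary B π := by
    -- A single good sample path already yields a stationary distribution.
    obtain ⟨ω, hω⟩ := hdef.exists
    obtain ⟨x, hx, hcl⟩ := hcompact.exists_mapClusterPt_of_frequently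
      (hmem fun i => τ.index (C i ω)).frequently
    exact ⟨x, τ.isStationary_of_mapClusterPt B hω hx hcl⟩
  have huniq : ∀ π', τ.IsStationary B π' → π' = π := by
    intro π' hπ'
    rw [isStationary_iff] at hπ hπ'
    exact fixed_probability_unique (τ.transition_nonneg B) (fun r s => (hirr r s).1)
      hπ.1 hπ.2.1 hπ.2.2 hπ'.2.1 hπ'.2.2
  refine ⟨π, hπ, huniq, ?_⟩
  filter_upwards [hdef, τ.ae_eq_index hC] with ω hω hidx
  have hv : Tendsto (τ.frequency B fun i => τ.index (C i ω)) atTop (𝓝 π) :=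
    hcompact.tendsto_nhds_of_unique_mapClusterPt (hmem _) fun x hx hcl =>
      huniq x (τ.isStationary_of_mapClusterPt B hω hx hcl)
  have hcont : Continuous (τ.missMass B) := by
    classical
    simp_rw [funext (τ.missMass_eq_sum B)]
    refine continuous_finsetSum _ fun s _ => ?_
    split_ifs <;> fun_prop
  have hceq : (fun n => C n ω) = fun n => τ.e (τ.index (C n ω)) := funext hidx
  rw [hceq]
  simp only [DMRFirst_eq]
  exact (hcont.tendsto π).comp hv

end SoftTask

end
theorem corollary2 {h : ℕ} (τ : SoftTask h) (B : SupplyFunctions τ.T)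
    {Ω : Type*} [MeasurableSpace Ω] (μ : Measure Ω) [IsProbabilityMeasure μ]
    (C : ℕ → Ω → ℝ) (hC : τ.IsExecutionTimes μ C) :
    (τ.IntegerData B → τ.ConstructionTerminates B) ∧
    (τ.ConstructionTerminates B → τ.StronglyConnected B →
      τ.ChainIrreducible B ∧
      ∃ π : τ.ChainState B → ℝ, τ.IsStationary B π ∧
        (∀ π' : τ.ChainState B → ℝ, τ.IsStationary B π' → π' = π) ∧
        τ.IsDeadlineMissRate B μ C (τ.missMass B π)) :=
  ⟨τ.terminates_of_integerData B, fun hfin hS =>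
    have hirr := τ.chainIrreducible_of_stronglyConnected B hS
    ⟨hirr, τ.exists_stationary_and_rate B hC hfin hirr⟩⟩
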